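/- For a tuple $\boldsymbol\alpha=(\alpha_1,\dots,\alpha_r)$ of positive integers, with $\alpha_r\ge 2$ if $r\ge 1$, put $$\zeta(\boldsymbol\alpha)=\sum_{1\le k_1<k_2<\cdots<k_r}k_1^{-\alpha_1}\cdots k_r^{-\alpha_r},\qquad \zeta^\star(\boldsymbol\alpha)=\sum_{1\le k_1\le k_2\le\cdots\le k_r}k_1^{-\alpha_1}\cdots k_r^{-\alpha_r},$$ with value $1$ for the empty tuple ($r=0$), and let $\{a\}^k$ denote $k$ repetitions of $a$. **Theorem 1.4.** For all integers $m,n\ge 0$, all the series below converge and $$\zeta^\star(\{1\}^m,\{2\}^{n+1})=\sum_{p+r=n}(-1)^r\,\zeta^\star(\{2\}^p)\sum_{d_1+\cdots+d_{r+1}=m}\zeta(d_1+2,\dots,d_{r+1}+2)\prod_{j=1}^{r+1}(d_j+1),$$ where $p,r$ and the $d_j$ run over nonnegative integers. -/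

import Mathlib

noncomputable section

/-- The term `k₁^{-α₁} ⋯ k_r^{-α_r}` of a multiple zeta(-star) series, for positive integers
`k₁, …, k_r`. For `r = 0` it is the empty product `1`. -/
def mzTerm {r : ℕ} (α : Fin r → ℕ) (k : Fin r → ℕ+) : ℝ :=
  ∏ i, (((k i : ℕ) : ℝ) ^ α i)⁻¹

/-- The family of terms of `ζ(α₁, …, α_r)`, indexed by `1 ≤ k₁ < k₂ < ⋯ < k_r`. -/
def mzvTerm {r : ℕ} (α : Fin r → ℕ) (k : {k : Fin r → ℕ+ // StrictMono k}) : ℝ :=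
  mzTerm α k.1

/-- The family of terms of `ζ⋆(α₁, …, α_r)`, indexed by `1 ≤ k₁ ≤ k₂ ≤ ⋯ ≤ k_r`. -/
def mzsvTerm {r : ℕ} (α : Fin r → ℕ) (k : {k : Fin r → ℕ+ // Monotone k}) : ℝ :=
  mzTerm α k.1

/-- The multiple zeta value `ζ(α₁, …, α_r)`. There is exactly one (empty) tuple for `r = 0`,
so that the value there is `1`. -/
def mzv {r : ℕ} (α : Fin r → ℕ) : ℝ := ∑' k, mzvTerm α k

/-- The multiple zeta-star value `ζ⋆(α₁, …, α_r)`, again `1` for `r = 0`. -/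
def mzsv {r : ℕ} (α : Fin r → ℕ) : ℝ := ∑' k, mzsvTerm α k

/-- The multi-index `({1}^a, {2}^b)`: `a` ones followed by `b` twos. -/
def onesTwos (a b : ℕ) : Fin (a + b) → ℕ :=
  Fin.append (fun _ : Fin a => 1) (fun _ : Fin b => 2)

/-- The multi-index `{2}^p`. -/
def twos (p : ℕ) : Fin p → ℕ := fun _ => 2

end

/-! Truncate all indices at `M` and use generating functions: `x` marks the ones (or the `d_j`), `y
= t ^ 2` the twos. Each last-index recurrence gives a product: the star sums over ones become `∏ k /
(k - x)`, those over twos `∏ (1 - y / k ^ 2)⁻¹`. For the mixed sums, multiplying by the inverse of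
the latter turns the recurrence into a telescoping sum whose increments are minus the terms of
`₂F₁(t, -t; 1 - x; 1)`. This yields the exact finite identity `X_mul_onesTwosBiSeries`.

As `M → ∞`, Gauss's theorem evaluates the hypergeometric sum as `∏ (1 - y / (k - x) ^ 2)`. Its
coefficient at `y ^ r` is `(-1) ^ r` times a sum over `k₁ < ⋯ < k_r` of `∏ (k_j - x)⁻²`, and
expanding in `x` produces the values `ζ(d_j + 2)` with weights `d_j + 1`. Comparing coefficients
proves the formula.

Gauss's theorem is needed only coefficientwise. The contiguous relation `gaussPartialSum_shift`
raises the lower parameter by one at the cost of one factor of the product and a boundary term.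
Iterating it `(M + 1) ^ 2` times leaves errors that tend to zero in a weighted `ℓ¹`-norm
(`exists_normLE_gauss`). Convergence of the mixed star series follows from the limit itself, since
all terms are nonnegative. -/

section

open Finset Filter Topology PowerSeries
open scoped ENNReal

/-! ### Index tuples and truncated multiple zeta sums. -/

/-- Weakly increasing `r`-tuples of natural numbers below `M`. -/
def monoTuples (r M : ℕ) : Finset (Fin r → ℕ) :=
  (Fintype.piFinset fun _ => range M).filter Monotone

/-- Strictly increasing `r`-tuples of natural numbers below `M`. -/
def strictTuples (r M : ℕ) : Finset (Fin r → ℕ) :=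
  (Fintype.piFinset fun _ => range M).filter StrictMono

lemma mem_monoTuples {r M : ℕ} {a : Fin r → ℕ} :
    a ∈ monoTuples r M ↔ (∀ i, a i < M) ∧ Monotone a := by
  simp [monoTuples]

lemma mem_strictTuples {r M : ℕ} {a : Fin r → ℕ} :
    a ∈ strictTuples r M ↔ (∀ i, a i < M) ∧ StrictMono a := by
  simp [strictTuples]

lemma snoc_mem_monoTuples {r M k : ℕ} {a : Fin r → ℕ} :
    (Fin.snoc a k : Fin (r + 1) → ℕ) ∈ monoTuples (r + 1) M ↔
      k < M ∧ a ∈ monoTuples r (k + 1) := by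
  simp only [mem_monoTuples]
  constructor
  · rintro ⟨h, hm⟩
    refine ⟨by simpa using h (Fin.last r), fun i => ?_, fun i j hij => ?_⟩
    · have := hm (Fin.le_last i.castSucc)
      simp only [Fin.snoc_castSucc, Fin.snoc_last] at this
      omega
    · have := hm (Fin.castSucc_le_castSucc_iff.2 hij)
      simpa using this
  · rintro ⟨hk, h, hm⟩
    refine ⟨fun i => ?_, fun i j hij => ?_⟩
    · induction i using Fin.lastCases with
      | last => simpa using hk
      | cast i => have := h i; simp only [Fin.snoc_castSucc]; omega
    · induction j using Fin.lastCases with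
      | last =>
        induction i using Fin.lastCases with
        | last => simp
        | cast i => have := h i; simp only [Fin.snoc_castSucc, Fin.snoc_last]; omega
      | cast j =>
        induction i using Fin.lastCases with
        | last => exact absurd hij (not_le.2 (Fin.castSucc_lt_last j))
        | cast i =>
          simp only [Fin.snoc_castSucc]
          exact hm (Fin.castSucc_le_castSucc_iff.1 hij)

lemma snoc_mem_strictTuples {r M k : ℕ} {a : Fin r → ℕ} :
    (Fin.snoc a k : Fin (r + 1) → ℕ) ∈ strictTuples (r + 1) M ↔
      k < M ∧ a ∈ strictTuples r k := by
  simp only [mem_strictTuples]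
  constructor
  · rintro ⟨h, hm⟩
    refine ⟨by simpa using h (Fin.last r), fun i => ?_, fun i j hij => ?_⟩
    · simpa using hm (Fin.castSucc_lt_last i)
    · simpa using hm (Fin.castSucc_lt_castSucc_iff.2 hij)
  · rintro ⟨hk, h, hm⟩
    refine ⟨fun i => ?_, fun i j hij => ?_⟩
    · induction i using Fin.lastCases with
      | last => simpa using hk
      | cast i => have := h i; simp only [Fin.snoc_castSucc]; omega
    · induction j using Fin.lastCases with
      | last =>
        induction i using Fin.lastCases with
        | last => exact absurd hij (lt_irrefl _)
        | cast i => simpa using h i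
      | cast j =>
        induction i using Fin.lastCases with
        | last => exact absurd hij (not_lt.2 (Fin.castSucc_lt_last j).le)
        | cast i =>
          simp only [Fin.snoc_castSucc]
          exact hm (Fin.castSucc_lt_castSucc_iff.1 hij)

lemma sum_monoTuples_succ {A : Type*} [AddCommMonoid A] (r M : ℕ) (f : (Fin (r + 1) → ℕ) → A) :
    ∑ a ∈ monoTuples (r + 1) M, f a =
      ∑ k ∈ range M, ∑ a ∈ monoTuples r (k + 1), f (Fin.snoc a k : Fin (r + 1) → ℕ) := by
  rw [Finset.sum_sigma']
  refine Finset.sum_nbij' (fun a => ⟨a (Fin.last r), Fin.init a⟩)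
    (fun p => (Fin.snoc p.2 p.1 : Fin (r + 1) → ℕ)) ?_ ?_ ?_ ?_ ?_
  · intro a ha
    rw [← Fin.snoc_init_self a, snoc_mem_monoTuples] at ha
    simpa using ha
  · rintro ⟨k, a⟩ h
    rw [snoc_mem_monoTuples]
    simpa using h
  · intro a _
    exact Fin.snoc_init_self a
  · rintro ⟨k, a⟩ _
    simp
  · intro a _
    simp

lemma sum_strictTuples_succ {A : Type*} [AddCommMonoid A] (r M : ℕ)
    (f : (Fin (r + 1) → ℕ) → A) :
    ∑ a ∈ strictTuples (r + 1) M, f a =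
      ∑ k ∈ range M, ∑ a ∈ strictTuples r k, f (Fin.snoc a k : Fin (r + 1) → ℕ) := by
  rw [Finset.sum_sigma']
  refine Finset.sum_nbij' (fun a => ⟨a (Fin.last r), Fin.init a⟩)
    (fun p => (Fin.snoc p.2 p.1 : Fin (r + 1) → ℕ)) ?_ ?_ ?_ ?_ ?_
  · intro a ha
    rw [← Fin.snoc_init_self a, snoc_mem_strictTuples] at ha
    simpa using ha
  · rintro ⟨k, a⟩ h
    rw [snoc_mem_strictTuples]
    simpa using h
  · intro a _
    exact Fin.snoc_init_self a
  · rintro ⟨k, a⟩ _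
    simp
  · intro a _
    simp

noncomputable section

/-- The term of a multiple zeta series at the shifted index tuple `a + 1`. -/
def shiftTerm {r : ℕ} (α : Fin r → ℕ) (a : Fin r → ℕ) : ℝ :=
  ∏ i, (((a i : ℝ) + 1) ^ α i)⁻¹

/-- The multiple zeta-star sum truncated to indices at most `M`. -/
def truncStar {r : ℕ} (α : Fin r → ℕ) (M : ℕ) : ℝ :=
  ∑ a ∈ monoTuples r M, shiftTerm α a

/-- The multiple zeta sum truncated to indices at most `M`. -/
def truncZeta {r : ℕ} (α : Fin r → ℕ) (M : ℕ) : ℝ :=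
  ∑ a ∈ strictTuples r M, shiftTerm α a

end

lemma shiftTerm_nonneg {r : ℕ} (α : Fin r → ℕ) (a : Fin r → ℕ) : 0 ≤ shiftTerm α a :=
  prod_nonneg fun _ _ => by positivity

lemma shiftTerm_snoc {r : ℕ} (α : Fin r → ℕ) (e : ℕ) (a : Fin r → ℕ) (k : ℕ) :
    shiftTerm (Fin.snoc α e : Fin (r + 1) → ℕ) (Fin.snoc a k : Fin (r + 1) → ℕ) =
      (((k : ℝ) + 1) ^ e)⁻¹ * shiftTerm α a := by
  simp [shiftTerm, Fin.prod_univ_castSucc, mul_comm]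

lemma truncStar_snoc {r : ℕ} (α : Fin r → ℕ) (e M : ℕ) :
    truncStar (Fin.snoc α e : Fin (r + 1) → ℕ) M =
      ∑ k ∈ range M, (((k : ℝ) + 1) ^ e)⁻¹ * truncStar α (k + 1) := by
  simp only [truncStar, sum_monoTuples_succ, shiftTerm_snoc, mul_sum]

lemma truncStar_snoc_succ {r : ℕ} (α : Fin r → ℕ) (e M : ℕ) :
    truncStar (Fin.snoc α e : Fin (r + 1) → ℕ) (M + 1) =
      truncStar (Fin.snoc α e : Fin (r + 1) → ℕ) M +
        (((M : ℝ) + 1) ^ e)⁻¹ * truncStar α (M + 1) := by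
  rw [truncStar_snoc, truncStar_snoc, sum_range_succ]

lemma truncStar_zero (α : Fin 0 → ℕ) (M : ℕ) : truncStar α M = 1 := by
  have : monoTuples 0 M = {Fin.elim0} := by
    ext a
    simp only [mem_monoTuples, mem_singleton]
    exact ⟨fun _ => Subsingleton.elim _ _, fun _ => ⟨fun i => i.elim0, fun i => i.elim0⟩⟩
  simp [truncStar, this, shiftTerm]

lemma strictTuples_zero (M : ℕ) : strictTuples 0 M = {Fin.elim0} := by
  ext a
  simp only [mem_strictTuples, mem_singleton]
  exact ⟨fun _ => Subsingleton.elim _ _, fun _ => ⟨fun i => i.elim0, fun i => i.elim0⟩⟩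

lemma onesTwos_succ (a b : ℕ) :
    onesTwos a (b + 1) = (Fin.snoc (onesTwos a b) 2 : Fin (a + b + 1) → ℕ) := by
  funext i
  induction i using Fin.lastCases with
  | last =>
    exact (Fin.append_right (fun _ : Fin a => 1) (fun _ : Fin (b + 1) => 2) (Fin.last b)).trans
      (Fin.snoc_last (α := fun _ => ℕ) 2 (onesTwos a b)).symm
  | cast i =>
    refine Eq.trans ?_ (Fin.snoc_castSucc (α := fun _ => ℕ) 2 (onesTwos a b) i).symm
    induction i using Fin.addCases with
    | left i =>
      have h1 := Fin.append_left (fun _ : Fin a => 1) (fun _ : Fin (b + 1) => 2) i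
      have h2 := Fin.append_left (fun _ : Fin a => 1) (fun _ : Fin b => 2) i
      exact h1.trans h2.symm
    | right i =>
      have h1 := Fin.append_right (fun _ : Fin a => 1) (fun _ : Fin (b + 1) => 2) i.castSucc
      have h2 := Fin.append_right (fun _ : Fin a => 1) (fun _ : Fin b => 2) i
      exact h1.trans h2.symm

lemma onesTwos_zero (a : ℕ) : onesTwos a 0 = fun _ : Fin a => 1 := by
  funext i
  exact Fin.append_left (fun _ : Fin a => 1) (fun _ : Fin 0 => 2) i

lemma snoc_const (r e : ℕ) :
    (Fin.snoc (fun _ : Fin r => e) e : Fin (r + 1) → ℕ) = fun _ => e := by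
  funext i
  induction i using Fin.lastCases with
  | last => simp
  | cast i => simp

/-! ### Infinite series as limits of truncations. -/

/-- The shift `a ↦ a + 1` from tuples of naturals to tuples of positive naturals. -/
def shiftEquiv (r : ℕ) : (Fin r → ℕ) ≃ (Fin r → ℕ+) :=
  Equiv.arrowCongr (Equiv.refl _) Equiv.pnatEquivNat.symm

lemma shiftEquiv_apply {r : ℕ} (a : Fin r → ℕ) (i : Fin r) :
    ((shiftEquiv r a i : ℕ+) : ℕ) = a i + 1 := by
  simp [shiftEquiv]

lemma mzTerm_shiftEquiv {r : ℕ} (α a : Fin r → ℕ) :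
    mzTerm α (shiftEquiv r a) = shiftTerm α a := by
  simp [mzTerm, shiftTerm, shiftEquiv_apply]

lemma monotone_shiftEquiv {r : ℕ} (a : Fin r → ℕ) : Monotone (shiftEquiv r a) ↔ Monotone a := by
  simp only [Monotone, ← PNat.coe_le_coe, shiftEquiv_apply, add_le_add_iff_right]

lemma strictMono_shiftEquiv {r : ℕ} (a : Fin r → ℕ) :
    StrictMono (shiftEquiv r a) ↔ StrictMono a := by
  simp only [StrictMono, ← PNat.coe_lt_coe, shiftEquiv_apply, add_lt_add_iff_right]

/-- A nonnegative sum over index tuples is the limit of its truncations, if these converge. -/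
lemma hasSum_of_tendsto_truncation {r : ℕ} (P : (Fin r → ℕ) → Prop) [DecidablePred P]
    {f : (Fin r → ℕ) → ℝ} (hf : ∀ a, 0 ≤ f a) {l : ℝ}
    (h : Tendsto (fun M => ∑ a ∈ (Fintype.piFinset fun _ => range M).filter P, f a)
      atTop (𝓝 l)) :
    HasSum (fun a : {a // P a} => f a) l := by
  classical
  let s : ℕ → Finset {a // P a} := fun M => (Fintype.piFinset fun _ => range M).subtype P
  have hs : ∀ M, ∑ a ∈ s M, f a = ∑ a ∈ (Fintype.piFinset fun _ => range M).filter P, f a :=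
    fun M => Finset.sum_subtype_eq_sum_filter (p := P) f
  have hmono : Monotone s := by
    intro M N hMN a
    simp only [s, mem_subtype, Fintype.mem_piFinset, mem_range]
    exact fun h i => (h i).trans_le hMN
  have hex : ∀ a, ∃ M, a ∈ s M := by
    intro a
    refine ⟨(∑ i, a.1 i) + 1, ?_⟩
    simp only [s, mem_subtype, Fintype.mem_piFinset, mem_range]
    exact fun i => Nat.lt_succ_of_le
      (single_le_sum (f := a.1) (fun _ _ => Nat.zero_le _) (mem_univ i))
  have hat : Tendsto s atTop atTop := tendsto_atTop_finset_of_monotone hmono hex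
  have hmon : Monotone fun M => ∑ a ∈ s M, f a := fun M N hMN =>
    sum_le_sum_of_subset_of_nonneg (hmono hMN) fun _ _ _ => hf _
  have h' : Tendsto (fun M => ∑ a ∈ s M, f a) atTop (𝓝 l) := by simpa only [hs] using h
  -- Every finite set lies in some box, and box sums increase to `l`; so `l` bounds all finite sums.
  have hsum : Summable fun a : {a // P a} => f a := by
    refine summable_of_sum_le (c := l) (fun _ => hf _) fun t => ?_
    obtain ⟨M, hM⟩ := (hat.eventually (eventually_ge_atTop t)).exists
    exact (sum_le_sum_of_subset_of_nonneg hM fun _ _ _ => hf _).trans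
      (hmon.ge_of_tendsto h' M)
  have := tendsto_nhds_unique (hsum.hasSum.comp hat) h'
  exact this ▸ hsum.hasSum

lemma hasSum_mzsvTerm {r : ℕ} {α : Fin r → ℕ} {l : ℝ}
    (h : Tendsto (truncStar α) atTop (𝓝 l)) : HasSum (mzsvTerm α) l := by
  let e : {a : Fin r → ℕ // Monotone a} ≃ {k : Fin r → ℕ+ // Monotone k} :=
    (shiftEquiv r).subtypeEquiv fun a => (monotone_shiftEquiv a).symm
  rw [← e.hasSum_iff]
  convert hasSum_of_tendsto_truncation Monotone (shiftTerm_nonneg α) h using 1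
  funext a
  exact mzTerm_shiftEquiv α a.1

lemma hasSum_mzvTerm {r : ℕ} {α : Fin r → ℕ} {l : ℝ}
    (h : Tendsto (truncZeta α) atTop (𝓝 l)) : HasSum (mzvTerm α) l := by
  let e : {a : Fin r → ℕ // StrictMono a} ≃ {k : Fin r → ℕ+ // StrictMono k} :=
    (shiftEquiv r).subtypeEquiv fun a => (strictMono_shiftEquiv a).symm
  rw [← e.hasSum_iff]
  convert hasSum_of_tendsto_truncation StrictMono (shiftTerm_nonneg α) h using 1
  funext a
  exact mzTerm_shiftEquiv α a.1

lemma summable_inv_succ_sq : Summable fun k : ℕ => (((k : ℝ) + 1) ^ 2)⁻¹ := by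
  have := (summable_nat_add_iff 1).2 (Real.summable_nat_pow_inv (p := 2).2 (by norm_num))
  simpa using this

/-- Without the order condition the sum over a box factors into one-variable sums, each at most `∑ 1
/ k ^ 2`. By nonnegativity this bounds the star and the strict truncations alike. -/
lemma sum_piFinset_shiftTerm_le {r : ℕ} {α : Fin r → ℕ} (hα : ∀ i, 2 ≤ α i) (M : ℕ) :
    ∑ a ∈ Fintype.piFinset fun _ : Fin r => range M, shiftTerm α a ≤
      (∑' k : ℕ, (((k : ℝ) + 1) ^ 2)⁻¹) ^ r := by
  have h := Finset.prod_univ_sum (fun _ : Fin r => range M)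
    (fun i k => (((k : ℝ) + 1) ^ α i)⁻¹)
  simp only [shiftTerm]
  rw [← h]
  calc _ ≤ ∏ _i : Fin r, ∑' k : ℕ, (((k : ℝ) + 1) ^ 2)⁻¹ := by
        refine prod_le_prod (fun _ _ => sum_nonneg fun _ _ => by positivity) fun i _ => ?_
        refine le_trans (sum_le_sum fun k _ => ?_)
          (summable_inv_succ_sq.sum_le_tsum (range M) fun _ _ => by positivity)
        have : (1 : ℝ) ≤ (k : ℝ) + 1 := by simp
        gcongr
        exact hα i
    _ = _ := by simp

lemma monotone_truncStar {r : ℕ} (α : Fin r → ℕ) : Monotone (truncStar α) := fun M N hMN =>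
  sum_le_sum_of_subset_of_nonneg
    (fun a => by simp only [mem_monoTuples]; exact fun h => ⟨fun i => (h.1 i).trans_le hMN, h.2⟩)
    fun _ _ _ => shiftTerm_nonneg _ _

lemma monotone_truncZeta {r : ℕ} (α : Fin r → ℕ) : Monotone (truncZeta α) := fun M N hMN =>
  sum_le_sum_of_subset_of_nonneg
    (fun a => by simp only [mem_strictTuples]; exact fun h => ⟨fun i => (h.1 i).trans_le hMN, h.2⟩)
    fun _ _ _ => shiftTerm_nonneg _ _

lemma exists_tendsto_truncStar {r : ℕ} {α : Fin r → ℕ} (hα : ∀ i, 2 ≤ α i) :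
    ∃ l, Tendsto (truncStar α) atTop (𝓝 l) :=
  ⟨_, tendsto_atTop_ciSup (monotone_truncStar α)
    ⟨(∑' k : ℕ, (((k : ℝ) + 1) ^ 2)⁻¹) ^ r, by
      rintro _ ⟨M, rfl⟩
      exact (sum_le_sum_of_subset_of_nonneg (filter_subset _ _)
        fun _ _ _ => shiftTerm_nonneg _ _).trans (sum_piFinset_shiftTerm_le hα M)⟩⟩

lemma exists_tendsto_truncZeta {r : ℕ} {α : Fin r → ℕ} (hα : ∀ i, 2 ≤ α i) :
    ∃ l, Tendsto (truncZeta α) atTop (𝓝 l) :=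
  ⟨_, tendsto_atTop_ciSup (monotone_truncZeta α)
    ⟨(∑' k : ℕ, (((k : ℝ) + 1) ^ 2)⁻¹) ^ r, by
      rintro _ ⟨M, rfl⟩
      exact (sum_le_sum_of_subset_of_nonneg (filter_subset _ _)
        fun _ _ _ => shiftTerm_nonneg _ _).trans (sum_piFinset_shiftTerm_le hα M)⟩⟩

lemma hasSum_mzsvTerm_of_two_le {r : ℕ} {α : Fin r → ℕ} (hα : ∀ i, 2 ≤ α i) :
    Summable (mzsvTerm α) ∧ Tendsto (truncStar α) atTop (𝓝 (mzsv α)) := by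
  obtain ⟨l, hl⟩ := exists_tendsto_truncStar hα
  have := hasSum_mzsvTerm hl
  exact ⟨this.summable, by rwa [mzsv, this.tsum_eq]⟩

lemma hasSum_mzvTerm_of_two_le {r : ℕ} {α : Fin r → ℕ} (hα : ∀ i, 2 ≤ α i) :
    Summable (mzvTerm α) ∧ Tendsto (truncZeta α) atTop (𝓝 (mzv α)) := by
  obtain ⟨l, hl⟩ := exists_tendsto_truncZeta hα
  have := hasSum_mzvTerm hl
  exact ⟨this.summable, by rwa [mzv, this.tsum_eq]⟩

/-! ### The Gauss series and its contiguous relation. -/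

noncomputable section

/-- The power series `1 / (k + 1 - X)`. -/
def shiftGeom (k : ℕ) : ℝ⟦X⟧ := PowerSeries.mk fun i => (((k : ℝ) + 1)⁻¹) ^ (i + 1)

lemma shiftGeom_mul (k : ℕ) : shiftGeom k * (((k : ℝ⟦X⟧) + 1) - X) = 1 := by
  have hk : (k : ℝ) + 1 ≠ 0 := by positivity
  have hc : (k : ℝ⟦X⟧) + 1 = PowerSeries.C ((k : ℝ) + 1) := by simp
  rw [hc]
  ext n
  rcases n with _ | n
  · simp [mul_sub, shiftGeom, hk]
  · simp only [mul_sub, map_sub, PowerSeries.coeff_mul_C, PowerSeries.coeff_succ_mul_X, shiftGeom,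
      PowerSeries.coeff_mk, PowerSeries.coeff_one]
    rw [pow_succ (((k : ℝ) + 1)⁻¹) (n + 1)]
    simp [hk]

/-- All `i + 1` products in the convolution coincide; this is the origin of the weights `d_j + 1`.
-/
lemma coeff_shiftGeom_sq (k i : ℕ) :
    coeff i (shiftGeom k ^ 2) = ((i : ℝ) + 1) * (((k : ℝ) + 1) ^ (i + 2))⁻¹ := by
  rw [sq, PowerSeries.coeff_mul]
  have : ∀ p ∈ antidiagonal i, coeff p.1 (shiftGeom k) * coeff p.2 (shiftGeom k) =
      (((k : ℝ) + 1) ^ (i + 2))⁻¹ := by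
    intro p hp
    rw [HasAntidiagonal.mem_antidiagonal] at hp
    simp only [shiftGeom, PowerSeries.coeff_mk, ← pow_add, ← inv_pow]
    congr 1
    omega
  rw [sum_congr rfl this]
  simp

/-- Formal power series in the variable `X` over `ℝ⟦X⟧`. -/
abbrev BiSeries : Type := (ℝ⟦X⟧)⟦X⟧

/-- The terms of the hypergeometric series `₂F₁(t, -t; s + 1 - x; 1)`, where `t ^ 2` is the outer
variable and `x` the inner one. -/
def gaussTerm (s : ℕ) : ℕ → BiSeries
  | 0 => 1
  | N + 1 => gaussTerm s N * ((N : BiSeries) ^ 2 - X) *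
      PowerSeries.C (PowerSeries.C (((N : ℝ) + 1)⁻¹) * shiftGeom (N + s))

/-- The partial sums of `₂F₁(t, -t; s + 1 - x; 1)`. -/
def gaussPartialSum (s M : ℕ) : BiSeries := ∑ N ∈ range M, gaussTerm s N

lemma C_inv_succ_mul (N : ℕ) :
    (PowerSeries.C (PowerSeries.C (((N : ℝ) + 1)⁻¹)) : BiSeries) * ((N : BiSeries) + 1) = 1 := by
  have hN : (N : ℝ) + 1 ≠ 0 := by positivity
  have : (N : BiSeries) + 1 = PowerSeries.C (PowerSeries.C ((N : ℝ) + 1)) := by simp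
  rw [this, ← map_mul, ← map_mul, inv_mul_cancel₀ hN]
  simp

lemma C_shiftGeom_mul (k : ℕ) :
    (PowerSeries.C (shiftGeom k) : BiSeries) * ((k : BiSeries) + 1 - PowerSeries.C X) = 1 := by
  have : (k : BiSeries) + 1 - PowerSeries.C X =
    PowerSeries.C (((k : ℝ⟦X⟧) + 1) - X) := by simp
  rw [this, ← map_mul, shiftGeom_mul, map_one]

lemma gaussTerm_succ (s N : ℕ) :
    gaussTerm s (N + 1) = gaussTerm s N * ((N : BiSeries) ^ 2 - X) *
      (PowerSeries.C (PowerSeries.C (((N : ℝ) + 1)⁻¹)) * PowerSeries.C (shiftGeom (N + s))) := by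
  rw [gaussTerm, map_mul]

/-- Only the lower Pochhammer symbol depends on `s`, and `c (c + 1)_N = (c)_N (c + N)` with `c = s +
1 - x`. -/
lemma gaussTerm_shift (s N : ℕ) :
    gaussTerm (s + 1) N * (((N + s : ℕ) : BiSeries) + 1 - PowerSeries.C X) =
      gaussTerm s N * ((s : BiSeries) + 1 - PowerSeries.C X) := by
  induction N with
  | zero => simp [gaussTerm]
  | succ N ih =>
    have e : N + 1 + s = N + (s + 1) := by ring
    have h1 := C_shiftGeom_mul (N + (s + 1))
    have h2 := C_shiftGeom_mul (N + s)
    rw [gaussTerm_succ, gaussTerm_succ, e]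
    push_cast at h1 h2 ih ⊢
    linear_combination
      (gaussTerm (s + 1) N * ((N : BiSeries) ^ 2 - X) *
        PowerSeries.C (PowerSeries.C (((N : ℝ) + 1)⁻¹))) * (h1 - h2) +
      (((N : BiSeries) ^ 2 - X) * PowerSeries.C (PowerSeries.C (((N : ℝ) + 1)⁻¹)) *
        PowerSeries.C (shiftGeom (N + s))) * ih

/-- The factors `1 - t ^ 2 / (s + 1 - x) ^ 2` of the product to which `₂F₁(t, -t; 1 - x; 1)`
evaluates. -/
def gaussFactor (s : ℕ) : BiSeries := 1 - X * PowerSeries.C (shiftGeom s ^ 2)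

/-- A telescoping certificate for the contiguous relation: once everything is expressed through
`gaussTerm s N`, it is a rational identity in `N`, `s`, `x`, `y`. -/
lemma gaussTerm_telescope (s N : ℕ) :
    gaussTerm s N - gaussFactor s * gaussTerm (s + 1) N =
      PowerSeries.C (shiftGeom s) *
        ((N : BiSeries) * gaussTerm s N - ((N + 1 : ℕ) : BiSeries) * gaussTerm s (N + 1)) := by
  have h0 := gaussTerm_shift s N
  have h1 := C_shiftGeom_mul s
  have h2 := C_shiftGeom_mul (N + s)
  have h3 := C_inv_succ_mul N
  have h4 : gaussTerm (s + 1) N = PowerSeries.C (shiftGeom (N + s)) *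
      (gaussTerm s N * ((s : BiSeries) + 1 - PowerSeries.C X)) := by
    rw [← h0]
    linear_combination (-gaussTerm (s + 1) N) * h2
  rw [gaussFactor, map_pow, gaussTerm_succ, h4]
  push_cast at h2 ⊢
  generalize gaussTerm s N = u at *
  generalize (PowerSeries.C (shiftGeom s) : BiSeries) = g at *
  generalize (PowerSeries.C (shiftGeom (N + s)) : BiSeries) = h at *
  generalize (PowerSeries.C (PowerSeries.C (((N : ℝ) + 1)⁻¹)) : BiSeries) = w at *
  generalize (PowerSeries.C X : BiSeries) = x at *
  generalize (X : BiSeries) = y at *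
  generalize (N : BiSeries) = n at *
  generalize (s : BiSeries) = t at *
  have e1 : g * (n * u - (n + 1) * (u * (n ^ 2 - y) * (w * h))) =
      g * (n * u - u * (n ^ 2 - y) * h) := by
    linear_combination (-g * u * (n ^ 2 - y) * h) * h3
  rw [e1]
  linear_combination (y * g * h * u - u * h * n) * h1 + (u * g * n - u) * h2

lemma gaussPartialSum_shift (s M : ℕ) :
    gaussPartialSum s M = gaussFactor s * gaussPartialSum (s + 1) M -
      PowerSeries.C (shiftGeom s) * ((M : BiSeries) * gaussTerm s M) := by
  induction M with
  | zero => simp [gaussPartialSum]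
  | succ M ih =>
    have h := gaussTerm_telescope s M
    simp only [gaussPartialSum, sum_range_succ] at ih ⊢
    linear_combination ih + h

lemma gaussPartialSum_zero_eq (M S : ℕ) :
    gaussPartialSum 0 M = (∏ s ∈ range S, gaussFactor s) * gaussPartialSum S M -
      ∑ s ∈ range S, (∏ i ∈ range s, gaussFactor i) *
        (PowerSeries.C (shiftGeom s) * ((M : BiSeries) * gaussTerm s M)) := by
  induction S with
  | zero => simp
  | succ S ih =>
    rw [ih, prod_range_succ, sum_range_succ, gaussPartialSum_shift S M]
    ring

end

/-! ### Weighted `ℓ¹`-norms on formal power series. -/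

noncomputable section

/-- The weighted `ℓ¹`-size of a power series, given a size of its coefficients. -/
def weightedSize {A : Type*} [Semiring A] (N : A → ℝ≥0∞) (r : ℝ≥0∞) (f : A⟦X⟧) : ℝ≥0∞ :=
  ∑' i, N (coeff i f) * r ^ i

section weightedSize

variable {A : Type*} [Ring A] {N : A → ℝ≥0∞} {r : ℝ≥0∞}

lemma weightedSize_zero (h0 : N 0 = 0) : weightedSize N r (0 : A⟦X⟧) = 0 := by
  simp [weightedSize, h0]

lemma weightedSize_add_le (hadd : ∀ a b, N (a + b) ≤ N a + N b) (f g : A⟦X⟧) :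
    weightedSize N r (f + g) ≤ weightedSize N r f + weightedSize N r g := by
  simp only [weightedSize, ← ENNReal.tsum_add, ← add_mul, map_add]
  exact ENNReal.tsum_le_tsum fun i => mul_le_mul_left (hadd _ _) _

lemma weightedSize_neg (hneg : ∀ a, N (-a) = N a) (f : A⟦X⟧) :
    weightedSize N r (-f) = weightedSize N r f := by
  simp [weightedSize, hneg]

lemma weightedSize_C (h0 : N 0 = 0) (a : A) : weightedSize N r (C a) = N a := by
  rw [weightedSize, tsum_eq_single 0]
  · simp
  · intro i hi
    simp [coeff_C, hi, h0]

lemma weightedSize_X (h0 : N 0 = 0) : weightedSize N r (X : A⟦X⟧) = N 1 * r := by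
  rw [weightedSize, tsum_eq_single 1]
  · simp
  · intro i hi
    simp [coeff_X, hi, h0]

/-- The Cauchy product with the triangle inequality; values in `ℝ≥0∞` avoid summability questions.
The coefficient size `N` is abstract so that the bound can be applied twice, first over `ℝ` and then
over `ℝ⟦X⟧`. -/
lemma weightedSize_mul_le (h0 : N 0 = 0) (hadd : ∀ a b, N (a + b) ≤ N a + N b)
    (hmul : ∀ a b, N (a * b) ≤ N a * N b) (f g : A⟦X⟧) :
    weightedSize N r (f * g) ≤ weightedSize N r f * weightedSize N r g := by
  have e : weightedSize N r f * weightedSize N r g =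
      ∑' i, ∑ p ∈ HasAntidiagonal.antidiagonal i,
        (N (coeff p.1 f) * r ^ p.1) * (N (coeff p.2 g) * r ^ p.2) := by
    simp only [weightedSize]
    rw [← ENNReal.tsum_mul_right]
    simp only [← ENNReal.tsum_mul_left]
    rw [← ENNReal.tsum_prod (f := fun i j => (N (coeff i f) * r ^ i) * (N (coeff j g) * r ^ j)),
      ← HasAntidiagonal.sigmaAntidiagonalEquivProd.tsum_eq, ENNReal.tsum_sigma']
    congr 1
    funext i
    rw [← Finset.tsum_subtype]
    rfl
  rw [e, weightedSize]
  refine ENNReal.tsum_le_tsum fun i => ?_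
  rw [PowerSeries.coeff_mul]
  calc _ ≤ (∑ p ∈ HasAntidiagonal.antidiagonal i, N (coeff p.1 f * coeff p.2 g)) * r ^ i := by
        gcongr
        exact le_sum_of_subadditive N h0.le hadd _ _
    _ ≤ _ := by
        rw [sum_mul]
        refine sum_le_sum fun p hp => ?_
        rw [HasAntidiagonal.mem_antidiagonal] at hp
        rw [← hp, pow_add, mul_mul_mul_comm]
        gcongr
        exact hmul _ _

lemma le_weightedSize (f : A⟦X⟧) (i : ℕ) : N (coeff i f) * r ^ i ≤ weightedSize N r f :=
  ENNReal.le_tsum i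

end weightedSize

/-- The weighted `ℓ¹`-norm on `ℝ⟦X⟧` with `X` of norm `1 / 2`. -/
def innerNorm : ℝ⟦X⟧ → ℝ≥0∞ := weightedSize (fun a : ℝ => ‖a‖ₑ) 2⁻¹

/-- The weighted `ℓ¹`-norm with inner variable of norm `1 / 2` and outer one of norm `1 / 32`. -/
def biNorm : BiSeries → ℝ≥0∞ := weightedSize innerNorm 32⁻¹

lemma innerNorm_mul_le (f g : ℝ⟦X⟧) : innerNorm (f * g) ≤ innerNorm f * innerNorm g :=
  weightedSize_mul_le (by simp) enorm_add_le (fun a b => (enorm_mul a b).le) f g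

lemma innerNorm_add_le (f g : ℝ⟦X⟧) : innerNorm (f + g) ≤ innerNorm f + innerNorm g :=
  weightedSize_add_le enorm_add_le f g

lemma innerNorm_zero : innerNorm 0 = 0 := weightedSize_zero (by simp)

lemma innerNorm_C (a : ℝ) : innerNorm (PowerSeries.C a) = ‖a‖ₑ := weightedSize_C (by simp) a

lemma innerNorm_neg (f : ℝ⟦X⟧) : innerNorm (-f) = innerNorm f := weightedSize_neg (by simp) f

/-- The coefficients are nonnegative, so the norm is the value of `1 / (k + 1 - x)` at `x = 1 / 2`.
-/
lemma innerNorm_shiftGeom (k : ℕ) :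
    innerNorm (shiftGeom k) = ENNReal.ofReal (((k : ℝ) + 1 / 2)⁻¹) := by
  have hk : (0 : ℝ) < (k : ℝ) + 1 := by positivity
  have h1 : ((k : ℝ) + 1)⁻¹ * 2⁻¹ < 1 := by
    have : ((k : ℝ) + 1)⁻¹ ≤ 1 := inv_le_one_of_one_le₀ (by simp)
    linarith
  have h2 : (2⁻¹ : ℝ≥0∞) = ENNReal.ofReal 2⁻¹ := by
    rw [ENNReal.ofReal_inv_of_pos (by norm_num)]; simp
  have h3 : ∀ i, ‖coeff i (shiftGeom k)‖ₑ * (2⁻¹ : ℝ≥0∞) ^ i =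
      ENNReal.ofReal (((k : ℝ) + 1)⁻¹ * ((((k : ℝ) + 1)⁻¹ * 2⁻¹) ^ i)) := by
    intro i
    rw [shiftGeom, PowerSeries.coeff_mk, Real.enorm_of_nonneg (by positivity), h2,
      ← ENNReal.ofReal_pow (by norm_num), ← ENNReal.ofReal_mul (by positivity)]
    congr 1
    ring
  rw [innerNorm, weightedSize, tsum_congr h3, ← ENNReal.ofReal_tsum_of_nonneg
    (fun i => by positivity) ((summable_geometric_of_lt_one (by positivity) h1).mul_left _),
    tsum_mul_left, tsum_geometric_of_lt_one (by positivity) h1]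
  congr 1
  rw [← mul_inv]
  congr 1
  field_simp
  ring

lemma biNorm_zero : biNorm 0 = 0 := weightedSize_zero innerNorm_zero

lemma biNorm_add_le (f g : BiSeries) : biNorm (f + g) ≤ biNorm f + biNorm g :=
  weightedSize_add_le innerNorm_add_le f g

lemma biNorm_mul_le (f g : BiSeries) : biNorm (f * g) ≤ biNorm f * biNorm g :=
  weightedSize_mul_le innerNorm_zero innerNorm_add_le innerNorm_mul_le f g

lemma biNorm_neg (f : BiSeries) : biNorm (-f) = biNorm f := weightedSize_neg innerNorm_neg f

lemma biNorm_C (f : ℝ⟦X⟧) : biNorm (PowerSeries.C f) = innerNorm f :=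
  weightedSize_C innerNorm_zero f

/-- The bound `c` on the weighted norm of a series. -/
def NormLE (f : BiSeries) (c : ℝ) : Prop := 0 ≤ c ∧ biNorm f ≤ ENNReal.ofReal c

namespace NormLE

variable {f g : BiSeries} {a b : ℝ}

lemma mono (hf : NormLE f a) (h : a ≤ b) : NormLE f b :=
  ⟨hf.1.trans h, hf.2.trans (ENNReal.ofReal_le_ofReal h)⟩

lemma add (hf : NormLE f a) (hg : NormLE g b) : NormLE (f + g) (a + b) :=
  ⟨add_nonneg hf.1 hg.1, by
    rw [ENNReal.ofReal_add hf.1 hg.1]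
    exact (biNorm_add_le f g).trans (add_le_add hf.2 hg.2)⟩

lemma neg (hf : NormLE f a) : NormLE (-f) a := ⟨hf.1, by rw [biNorm_neg]; exact hf.2⟩

lemma sub (hf : NormLE f a) (hg : NormLE g b) : NormLE (f - g) (a + b) := by
  rw [sub_eq_add_neg]
  exact hf.add hg.neg

lemma mul (hf : NormLE f a) (hg : NormLE g b) : NormLE (f * g) (a * b) :=
  ⟨mul_nonneg hf.1 hg.1, by
    rw [ENNReal.ofReal_mul hf.1]
    exact (biNorm_mul_le f g).trans (mul_le_mul' hf.2 hg.2)⟩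

lemma zero : NormLE 0 0 := ⟨le_rfl, by simp [biNorm_zero]⟩

lemma const (a : ℝ) : NormLE (PowerSeries.C (PowerSeries.C a)) |a| :=
  ⟨abs_nonneg a, by rw [biNorm_C, innerNorm_C, Real.enorm_eq_ofReal_abs]⟩

lemma one : NormLE 1 1 := by simpa using const 1

lemma natCast (n : ℕ) : NormLE (n : BiSeries) n := by simpa using const (n : ℝ)

lemma var : NormLE (X : BiSeries) (1 / 32) := by
  refine ⟨by norm_num, ?_⟩
  have h : innerNorm 1 = 1 := by
    rw [← map_one (PowerSeries.C (R := ℝ)), innerNorm_C]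
    simp
  rw [biNorm, weightedSize_X innerNorm_zero, h, one_div, ENNReal.ofReal_inv_of_pos (by norm_num)]
  simp

lemma shiftGeom (k : ℕ) : NormLE (PowerSeries.C (_root_.shiftGeom k)) (((k : ℝ) + 1 / 2)⁻¹) :=
  ⟨by positivity, by rw [biNorm_C, innerNorm_shiftGeom]⟩

lemma sum {ι : Type*} {s : Finset ι} {f : ι → BiSeries} {a : ι → ℝ}
    (h : ∀ i ∈ s, NormLE (f i) (a i)) : NormLE (∑ i ∈ s, f i) (∑ i ∈ s, a i) := by
  classical
  induction s using Finset.induction_on with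
  | empty => simpa using zero
  | insert i s hi ih =>
    rw [sum_insert hi, sum_insert hi]
    exact (h i (mem_insert_self i s)).add (ih fun j hj => h j (mem_insert_of_mem hj))

lemma prod {ι : Type*} {s : Finset ι} {f : ι → BiSeries} {a : ι → ℝ}
    (h : ∀ i ∈ s, NormLE (f i) (a i)) : NormLE (∏ i ∈ s, f i) (∏ i ∈ s, a i) := by
  classical
  induction s using Finset.induction_on with
  | empty => simpa using one
  | insert i s hi ih =>
    rw [prod_insert hi, prod_insert hi]
    exact (h i (mem_insert_self i s)).mul (ih fun j hj => h j (mem_insert_of_mem hj))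

/-- Norm bounds control each coefficient, so convergence in norm implies coefficientwise
convergence. -/
lemma abs_coeff_le (hf : NormLE f a) (i j : ℕ) :
    |coeff j (coeff i f)| ≤ a * (32 ^ i * 2 ^ j) := by
  have h1 : ‖coeff j (coeff i f)‖ₑ * (2⁻¹) ^ j * (32⁻¹) ^ i ≤ ENNReal.ofReal a :=
    (mul_le_mul_left (le_weightedSize (N := fun a : ℝ => ‖a‖ₑ) (coeff i f) j) _).trans
      ((le_weightedSize (N := innerNorm) f i).trans hf.2)
  have h2 : (2⁻¹ : ℝ≥0∞) = ENNReal.ofReal 2⁻¹ := by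
    rw [ENNReal.ofReal_inv_of_pos (by norm_num)]; simp
  have h3 : (32⁻¹ : ℝ≥0∞) = ENNReal.ofReal 32⁻¹ := by
    rw [ENNReal.ofReal_inv_of_pos (by norm_num)]; simp
  rw [Real.enorm_eq_ofReal_abs, h2, h3, ← ENNReal.ofReal_pow (by norm_num),
    ← ENNReal.ofReal_pow (by norm_num), ← ENNReal.ofReal_mul (by positivity),
    ← ENNReal.ofReal_mul (by positivity), ENNReal.ofReal_le_ofReal_iff hf.1] at h1
  have h4 : |coeff j (coeff i f)| =
      |coeff j (coeff i f)| * 2⁻¹ ^ j * 32⁻¹ ^ i * (32 ^ i * 2 ^ j) := by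
    simp only [inv_pow]
    field_simp
  rw [h4]
  gcongr

end NormLE

end

/-! ### Estimates and the coefficientwise Gauss theorem. -/

lemma summable_inv_add_half_sq : Summable fun k : ℕ => (((k : ℝ) + 1 / 2)⁻¹) ^ 2 := by
  refine Summable.of_nonneg_of_le (fun _ => by positivity) (fun k => ?_)
    (summable_inv_succ_sq.mul_left 4)
  have : (4 : ℝ) * (((k : ℝ) + 1) ^ 2)⁻¹ = ((((k : ℝ) + 1) / 2)⁻¹) ^ 2 := by
    field_simp
    norm_num
  rw [this]
  gcongr
  linarith [(Nat.cast_nonneg k : (0 : ℝ) ≤ k)]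

lemma normLE_gaussFactor (s : ℕ) :
    NormLE (gaussFactor s) (1 + (((s : ℝ) + 1 / 2)⁻¹) ^ 2) := by
  have h := NormLE.one.sub (NormLE.var.mul ((NormLE.shiftGeom s).mul (NormLE.shiftGeom s)))
  have e : gaussFactor s = 1 - X * (PowerSeries.C (shiftGeom s) * PowerSeries.C (shiftGeom s)) := by
    rw [gaussFactor, map_pow, sq]
  rw [e]
  refine h.mono ?_
  rw [← sq]
  have : (0 : ℝ) ≤ (((s : ℝ) + 1 / 2)⁻¹) ^ 2 := by positivity
  linarith

/-- The point is uniformity in `S`, from `1 + u ≤ exp u`. -/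
lemma normLE_prod_gaussFactor (S : ℕ) :
    NormLE (∏ s ∈ range S, gaussFactor s)
      (Real.exp (∑' k : ℕ, (((k : ℝ) + 1 / 2)⁻¹) ^ 2)) := by
  refine (NormLE.prod fun s _ => normLE_gaussFactor s).mono ?_
  calc _ ≤ ∏ s ∈ range S, Real.exp ((((s : ℝ) + 1 / 2)⁻¹) ^ 2) :=
        prod_le_prod (fun _ _ => by positivity) fun s _ => by
          rw [add_comm]; exact Real.add_one_le_exp _
    _ = Real.exp (∑ s ∈ range S, (((s : ℝ) + 1 / 2)⁻¹) ^ 2) := (Real.exp_sum _ _).symm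
    _ ≤ _ := Real.exp_le_exp.2
        (summable_inv_add_half_sq.sum_le_tsum _ fun _ _ => by positivity)

/-- With `t = n + 1` and `s = 0`, the worst case, this says `(t + 1 / (32 t)) / (t + 1 / 2) ≤ √(t /
(t + 1))`. Both sides are `1 - 1 / (2 t)` to first order; at second order the coefficients are `9 /
32` and `3 / 8`, so the small weight of `y` leaves room. -/
lemma gaussTerm_ratio_le (n s : ℕ) :
    (√((n : ℝ) + 1))⁻¹ * (((n : ℝ) + 1) + ((n : ℝ) + 1)⁻¹ * (1 / 32)) *
      (((n + 1 + s : ℕ) : ℝ) + 1 / 2)⁻¹ ≤ (√((n : ℝ) + 1 + 1))⁻¹ := by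
  set t : ℝ := (n : ℝ) + 1 with ht
  have ht1 : 1 ≤ t := by simp [ht]
  have ht0 : 0 < t := by linarith
  have h1 : (((n + 1 + s : ℕ) : ℝ) + 1 / 2)⁻¹ ≤ (t + 1 / 2)⁻¹ := by
    apply inv_anti₀ (by positivity)
    push_cast
    rw [ht]
    linarith [(Nat.cast_nonneg s : (0 : ℝ) ≤ s)]
  refine (mul_le_mul_of_nonneg_left h1 (by positivity)).trans ?_
  refine (pow_le_pow_iff_left₀ (by positivity) (by positivity) two_ne_zero).1 ?_
  rw [mul_pow, mul_pow, inv_pow, inv_pow, inv_pow, Real.sq_sqrt ht0.le,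
    Real.sq_sqrt (by positivity)]
  have h2 : t + t⁻¹ * (1 / 32) = (32 * t ^ 2 + 1) / (32 * t) := by field_simp
  rw [h2, ← one_div, ← one_div, ← one_div, div_pow, div_mul_div_comm, div_mul_div_comm,
    div_le_div_iff₀ (by positivity) (by positivity)]
  have hu : (0 : ℝ) ≤ n := Nat.cast_nonneg n
  rw [ht]
  ring_nf
  nlinarith [pow_nonneg hu 2, pow_nonneg hu 3, pow_nonneg hu 4, pow_nonneg hu 5]

/-- The decay in `n` makes the boundary terms of the contiguous relation vanish, and the factor `1 /
(s + 1 / 2)` makes their sum over `s` converge. -/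
lemma normLE_mul_gaussTerm (s n : ℕ) :
    NormLE (((n + 1 : ℕ) : BiSeries) * gaussTerm s (n + 1))
      (((s : ℝ) + 1 / 2)⁻¹ * (√((n : ℝ) + 1))⁻¹) := by
  induction n with
  | zero =>
    have h := (NormLE.var.neg.mul (NormLE.shiftGeom s)).mono
      (b := ((s : ℝ) + 1 / 2)⁻¹ * (√(((0 : ℕ) : ℝ) + 1))⁻¹) (by
        have : (0 : ℝ) ≤ ((s : ℝ) + 1 / 2)⁻¹ := by positivity
        simp only [CharP.cast_eq_zero, zero_add, Real.sqrt_one, inv_one, mul_one]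
        linarith)
    convert h using 1
    simp [gaussTerm]
  | succ n ih =>
    have e1 := C_inv_succ_mul (n + 1)
    have e0 := C_inv_succ_mul n
    -- The ratio of consecutive terms, with one factor `n + 1` kept in the induction hypothesis.
    have e : (((n + 1 + 1 : ℕ) : BiSeries) * gaussTerm s (n + 1 + 1)) =
        (((n + 1 : ℕ) : BiSeries) * gaussTerm s (n + 1)) *
          (((n + 1 : ℕ) : BiSeries) - PowerSeries.C (PowerSeries.C (((n : ℝ) + 1)⁻¹)) * X) *
          PowerSeries.C (shiftGeom (n + 1 + s)) := by
      rw [gaussTerm_succ s (n + 1)]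
      push_cast at e1 ⊢
      linear_combination
        (gaussTerm s (n + 1) * (((n : BiSeries) + 1) ^ 2 - X) *
          PowerSeries.C (shiftGeom (n + 1 + s))) * e1 +
        gaussTerm s (n + 1) * X * PowerSeries.C (shiftGeom (n + 1 + s)) * e0
    rw [e]
    refine ((ih.mul ((NormLE.natCast (n + 1)).sub ((NormLE.const _).mul NormLE.var))).mul
      (NormLE.shiftGeom (n + 1 + s))).mono ?_
    rw [abs_of_nonneg (by positivity)]
    have := mul_le_mul_of_nonneg_left (gaussTerm_ratio_le n s)
      (by positivity : (0 : ℝ) ≤ ((s : ℝ) + 1 / 2)⁻¹)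
    push_cast at this ⊢
    linarith

lemma normLE_gaussTerm (s n : ℕ) :
    NormLE (gaussTerm s (n + 1)) (((s : ℝ) + 1 / 2)⁻¹) := by
  have e0 := C_inv_succ_mul n
  have e : gaussTerm s (n + 1) = PowerSeries.C (PowerSeries.C (((n : ℝ) + 1)⁻¹)) *
      (((n + 1 : ℕ) : BiSeries) * gaussTerm s (n + 1)) := by
    push_cast
    linear_combination (-gaussTerm s (n + 1)) * e0
  rw [e]
  refine ((NormLE.const _).mul (normLE_mul_gaussTerm s n)).mono ?_
  rw [abs_of_nonneg (by positivity)]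
  have h1 : ((n : ℝ) + 1)⁻¹ ≤ 1 := inv_le_one_of_one_le₀ (by simp)
  have h2 : (√((n : ℝ) + 1))⁻¹ ≤ 1 := inv_le_one_of_one_le₀ (by simp)
  calc _ ≤ 1 * (((s : ℝ) + 1 / 2)⁻¹ * 1) := by gcongr
    _ = _ := by ring

lemma normLE_gaussPartialSum_sub_one (s M : ℕ) :
    NormLE (gaussPartialSum s (M + 1) - 1) (M * ((s : ℝ) + 1 / 2)⁻¹) := by
  have e : gaussPartialSum s (M + 1) - 1 = ∑ n ∈ range M, gaussTerm s (n + 1) := by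
    rw [gaussPartialSum, sum_range_succ', gaussTerm, add_sub_cancel_right]
  rw [e]
  simpa using NormLE.sum (s := range M) fun n _ => normLE_gaussTerm s n

/-- After `S` shifts the remaining Gauss sum differs from `1` by at most about `M / S`; the choice
`S = (M + 1) ^ 2` makes this small, while the boundary terms are bounded uniformly in `S`. -/
lemma exists_normLE_gauss : ∃ c : ℝ, ∀ M : ℕ,
    NormLE (gaussPartialSum 0 (M + 1) - ∏ s ∈ range ((M + 1) ^ 2), gaussFactor s)
      (c * (√((M : ℝ) + 1))⁻¹) := by
  set K : ℝ := ∑' k : ℕ, (((k : ℝ) + 1 / 2)⁻¹) ^ 2 with hK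
  refine ⟨Real.exp K * (1 + K), fun M => ?_⟩
  have e : gaussPartialSum 0 (M + 1) - ∏ s ∈ range ((M + 1) ^ 2), gaussFactor s =
      (∏ s ∈ range ((M + 1) ^ 2), gaussFactor s) *
        (gaussPartialSum ((M + 1) ^ 2) (M + 1) - 1) -
      ∑ s ∈ range ((M + 1) ^ 2), (∏ i ∈ range s, gaussFactor i) *
        (PowerSeries.C (shiftGeom s) * (((M + 1 : ℕ) : BiSeries) * gaussTerm s (M + 1))) := by
    rw [gaussPartialSum_zero_eq (M + 1) ((M + 1) ^ 2)]
    ring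
  rw [e]
  refine (((normLE_prod_gaussFactor _).mul (normLE_gaussPartialSum_sub_one _ M)).sub
    (NormLE.sum fun s _ => (normLE_prod_gaussFactor s).mul
      ((NormLE.shiftGeom s).mul (normLE_mul_gaussTerm s M)))).mono ?_
  rw [← hK, mul_assoc (Real.exp K), add_mul, one_mul, mul_add, ← mul_sum]
  have h1 : (M : ℝ) * ((((M + 1) ^ 2 : ℕ) : ℝ) + 1 / 2)⁻¹ ≤ (√((M : ℝ) + 1))⁻¹ := by
    have hM : (0 : ℝ) ≤ M := Nat.cast_nonneg M
    have h2 : √((M : ℝ) + 1) ≤ (M : ℝ) + 1 := Real.sqrt_le_iff.2 ⟨by linarith, by nlinarith⟩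
    rw [← div_eq_mul_inv, ← one_div, div_le_div_iff₀ (by positivity) (by positivity)]
    push_cast
    nlinarith [Real.sqrt_nonneg ((M : ℝ) + 1)]
  have h2 : ∑ s ∈ range ((M + 1) ^ 2), (((s : ℝ) + 1 / 2)⁻¹ *
      (((s : ℝ) + 1 / 2)⁻¹ * (√((M : ℝ) + 1))⁻¹)) ≤ K * (√((M : ℝ) + 1))⁻¹ := by
    simp only [← mul_assoc, ← sum_mul, ← sq]
    gcongr
    exact summable_inv_add_half_sq.sum_le_tsum _ fun _ _ => by positivity
  gcongr

lemma tendsto_coeff_gauss (i j : ℕ) :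
    Tendsto (fun M : ℕ => coeff j (coeff i (gaussPartialSum 0 (M + 1))) -
      coeff j (coeff i (∏ s ∈ range ((M + 1) ^ 2), gaussFactor s))) atTop (𝓝 0) := by
  obtain ⟨c, hc⟩ := exists_normLE_gauss
  have h0 : Tendsto (fun M : ℕ => c * (√((M : ℝ) + 1))⁻¹ * (32 ^ i * 2 ^ j)) atTop (𝓝 0) := by
    have : Tendsto (fun M : ℕ => (√((M : ℝ) + 1))⁻¹) atTop (𝓝 0) :=
      tendsto_inv_atTop_zero.comp (Real.tendsto_sqrt_atTop.comp
        (tendsto_atTop_add_const_right _ _ tendsto_natCast_atTop_atTop))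
    simpa using (this.const_mul c).mul_const ((32 : ℝ) ^ i * 2 ^ j)
  refine squeeze_zero_norm (fun M => ?_) h0
  have := (hc M).abs_coeff_le i j
  simpa using this

/-! ### Coefficients of the Gauss product. -/

/-- Choosing `r` distinct factors is choosing a strict tuple; the new factor `M`, if chosen, is its
last entry. -/
lemma coeff_prod_gaussFactor (r M : ℕ) :
    coeff r (∏ s ∈ range M, gaussFactor s) =
      (-1) ^ r * ∑ a ∈ strictTuples r M, ∏ j, shiftGeom (a j) ^ 2 := by
  induction M generalizing r with
  | zero =>
    rcases r with _ | r
    · simp [strictTuples_zero]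
    · simp [sum_strictTuples_succ, coeff_one]
  | succ M ih =>
    rw [prod_range_succ, gaussFactor, mul_sub, mul_one, map_sub, ih]
    rcases r with _ | r
    · simp [strictTuples_zero, mul_left_comm _ X]
    · rw [mul_left_comm, coeff_succ_X_mul, coeff_mul_C, ih, sum_strictTuples_succ,
        sum_strictTuples_succ, sum_range_succ]
      simp only [Fin.prod_univ_castSucc, Fin.snoc_castSucc, Fin.snoc_last, ← sum_mul]
      ring

lemma coeff_prod_shiftGeom_sq {r : ℕ} (a : Fin r → ℕ) (m : ℕ) :
    coeff m (∏ j, shiftGeom (a j) ^ 2) =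
      ∑ d ∈ Finset.Nat.antidiagonalTuple r m,
        shiftTerm (fun j => d j + 2) a * ∏ j, ((d j : ℝ) + 1) := by
  rw [coeff_prod]
  refine sum_nbij' (fun l => (l : Fin r → ℕ)) (fun d => Finsupp.equivFunOnFinite.symm d)
    ?_ ?_ ?_ ?_ ?_
  · intro l hl
    rw [mem_finsuppAntidiag] at hl
    exact Finset.Nat.mem_antidiagonalTuple.2 hl.1
  · intro d hd
    rw [mem_finsuppAntidiag]
    exact ⟨Finset.Nat.mem_antidiagonalTuple.1 hd, subset_univ _⟩
  · intro l _
    ext i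
    simp
  · intro d _
    ext i
    simp
  · intro l _
    rw [shiftTerm, ← prod_mul_distrib]
    refine prod_congr rfl fun j _ => ?_
    rw [coeff_shiftGeom_sq, mul_comm]

lemma coeff_coeff_prod_gaussFactor (r m M : ℕ) :
    coeff m (coeff r (∏ s ∈ range M, gaussFactor s)) =
      (-1) ^ r * ∑ d ∈ Finset.Nat.antidiagonalTuple r m,
        truncZeta (fun j => d j + 2) M * ∏ j, ((d j : ℝ) + 1) := by
  have e : ((-1 : ℝ⟦X⟧)) ^ r = PowerSeries.C ((-1) ^ r) := by simp
  rw [coeff_prod_gaussFactor, e, coeff_C_mul, map_sum]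
  simp only [coeff_prod_shiftGeom_sq, truncZeta, sum_mul]
  rw [sum_comm]

lemma tendsto_coeff_gaussPartialSum (r m : ℕ) :
    Tendsto (fun M : ℕ => coeff m (coeff r (gaussPartialSum 0 (M + 1)))) atTop
      (𝓝 ((-1) ^ r * ∑ d ∈ Finset.Nat.antidiagonalTuple r m,
        mzv (fun j => d j + 2) * ∏ j, ((d j : ℝ) + 1))) := by
  have h1 : Tendsto (fun M : ℕ => coeff m (coeff r (∏ s ∈ range M, gaussFactor s))) atTop
      (𝓝 ((-1) ^ r * ∑ d ∈ Finset.Nat.antidiagonalTuple r m,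
        mzv (fun j => d j + 2) * ∏ j, ((d j : ℝ) + 1))) := by
    simp only [coeff_coeff_prod_gaussFactor]
    exact (tendsto_finsetSum _ fun d _ =>
      (hasSum_mzvTerm_of_two_le (α := fun j => d j + 2) fun i => by simp).2.mul_const _).const_mul _
  -- The product was compared along `(M + 1) ^ 2` factors; its coefficients converge, so this
  -- subsequence has the same limit.
  have h2 : Tendsto (fun M : ℕ => (M + 1) ^ 2) atTop atTop :=
    (tendsto_pow_atTop two_ne_zero).comp (tendsto_add_atTop_nat 1)
  simpa using (tendsto_coeff_gauss r m).add (h1.comp h2)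

/-! ### Generating functions of the truncated star sums. -/

noncomputable section

/-- The generating function of the truncated values `ζ⋆({1}^m, {2}^b)` in `m`. -/
def onesTwosSeries (b M : ℕ) : ℝ⟦X⟧ := PowerSeries.mk fun m => truncStar (onesTwos m b) M

/-- The generating function of the truncated values `ζ⋆({1}^m, {2}^(b + 1))` in `m` and `b`. -/
def onesTwosBiSeries (M : ℕ) : BiSeries := PowerSeries.mk fun b => onesTwosSeries (b + 1) M

/-- The generating function of the truncated values `ζ⋆({2}^p)` in `p`. -/
def twosBiSeries (M : ℕ) : BiSeries :=
  PowerSeries.mk fun p => PowerSeries.C (truncStar (twos p) M)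

end

lemma truncStar_zero_right {r : ℕ} (α : Fin (r + 1) → ℕ) : truncStar α 0 = 0 := by
  simp [truncStar, sum_monoTuples_succ]

lemma truncStar_ones_succ (m M : ℕ) :
    truncStar (onesTwos (m + 1) 0) (M + 1) =
      truncStar (onesTwos (m + 1) 0) M + ((M : ℝ) + 1)⁻¹ * truncStar (onesTwos m 0) (M + 1) := by
  have h := truncStar_snoc_succ (fun _ : Fin m => 1) 1 M
  rw [snoc_const, pow_one] at h
  simpa only [onesTwos_zero] using h

lemma onesTwosSeries_zero_succ (M : ℕ) :
    onesTwosSeries 0 (M + 1) =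
      onesTwosSeries 0 M + PowerSeries.C (((M : ℝ) + 1)⁻¹) * X * onesTwosSeries 0 (M + 1) := by
  ext m
  rw [map_add, mul_assoc, coeff_C_mul]
  rcases m with _ | m
  · have h : ∀ N, truncStar (onesTwos 0 0) N = 1 := fun N => truncStar_zero _ _
    simp [onesTwosSeries, h]
  · rw [coeff_succ_X_mul]
    simp only [onesTwosSeries, PowerSeries.coeff_mk]
    exact truncStar_ones_succ m M

lemma onesTwosSeries_zero_zero : onesTwosSeries 0 0 = 1 := by
  ext m
  rw [onesTwosSeries, PowerSeries.coeff_mk]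
  rcases m with _ | m
  · simpa using truncStar_zero (onesTwos 0 0) 0
  · simpa [coeff_one] using truncStar_zero_right (r := m) (onesTwos (m + 1) 0)

/-- The preceding recurrence is implicit because the top index may repeat; solving it gives the
factor `k / (k - x)` with `k = M + 1`. -/
lemma onesTwosSeries_zero_succ' (M : ℕ) :
    onesTwosSeries 0 (M + 1) = ((M : ℝ⟦X⟧) + 1) * shiftGeom M * onesTwosSeries 0 M := by
  have h := onesTwosSeries_zero_succ M
  have h1 := shiftGeom_mul M
  have hM : (M : ℝ) + 1 ≠ 0 := by positivity
  have h2 : ((M : ℝ⟦X⟧) + 1) * PowerSeries.C (((M : ℝ) + 1)⁻¹) = 1 := by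
    have : (M : ℝ⟦X⟧) + 1 = PowerSeries.C ((M : ℝ) + 1) := by simp
    rw [this, ← map_mul, mul_inv_cancel₀ hM, map_one]
  linear_combination ((M : ℝ⟦X⟧) + 1) * shiftGeom M * h - onesTwosSeries 0 (M + 1) * h1 +
    shiftGeom M * X * onesTwosSeries 0 (M + 1) * h2

lemma onesTwosBiSeries_succ (M : ℕ) :
    onesTwosBiSeries (M + 1) = onesTwosBiSeries M +
      PowerSeries.C (PowerSeries.C (((M : ℝ) + 1)⁻¹ ^ 2)) *
        (PowerSeries.C (onesTwosSeries 0 (M + 1)) + X * onesTwosBiSeries (M + 1)) := by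
  have h : ∀ b, coeff b (PowerSeries.C (onesTwosSeries 0 (M + 1)) +
      X * onesTwosBiSeries (M + 1)) = onesTwosSeries b (M + 1) := by
    rintro (_ | b)
    · simp
    · simp [onesTwosBiSeries, coeff_succ_X_mul]
  ext b m
  rw [map_add, coeff_C_mul, h, map_add, coeff_C_mul]
  simp only [onesTwosBiSeries, onesTwosSeries, PowerSeries.coeff_mk]
  have := truncStar_snoc_succ (onesTwos m b) 2 M
  rw [← inv_pow] at this
  rw [onesTwos_succ]
  exact this

lemma onesTwosBiSeries_zero : onesTwosBiSeries 0 = 0 := by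
  ext b m
  simpa [onesTwosBiSeries, onesTwosSeries] using
    truncStar_zero_right (r := m + b) (onesTwos m (b + 1))

lemma twosBiSeries_succ (M : ℕ) :
    twosBiSeries (M + 1) = twosBiSeries M +
      PowerSeries.C (PowerSeries.C (((M : ℝ) + 1)⁻¹ ^ 2)) * (X * twosBiSeries (M + 1)) := by
  ext p : 1
  rw [map_add, coeff_C_mul]
  rcases p with _ | p
  · simp [twosBiSeries, truncStar_zero]
  · rw [coeff_succ_X_mul]
    simp only [twosBiSeries, PowerSeries.coeff_mk, ← map_mul, ← map_add]
    congr 1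
    have := truncStar_snoc_succ (twos p) 2 M
    rw [← inv_pow] at this
    have e : (Fin.snoc (twos p) 2 : Fin (p + 1) → ℕ) = twos (p + 1) := snoc_const p 2
    rwa [e] at this

lemma twosBiSeries_zero : twosBiSeries 0 = 1 := by
  ext p : 1
  rcases p with _ | p
  · simp [twosBiSeries, truncStar_zero]
  · simp [twosBiSeries, truncStar_zero_right, coeff_one]

/-- The inverse of `twosBiSeries`. -/
noncomputable def sineProd (M : ℕ) : BiSeries :=
  ∏ k ∈ range M, (1 - PowerSeries.C (PowerSeries.C (((k : ℝ) + 1)⁻¹ ^ 2)) * X)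

lemma twosBiSeries_mul_sineProd (M : ℕ) : twosBiSeries M * sineProd M = 1 := by
  induction M with
  | zero => simp [twosBiSeries_zero, sineProd]
  | succ M ih =>
    rw [sineProd, prod_range_succ, ← sineProd]
    linear_combination ih + sineProd M * twosBiSeries_succ M

/-- In the numerator `∏ (k ^ 2 - y)` over `0 ≤ k ≤ M`, the factor `k = 0` gives `-y` and the others
give `(M!) ^ 2` times `sineProd M`. The denominator is `((M + 1)!) ^ 2` divided by the series for
ones. -/
lemma gaussTerm_zero_eq (M : ℕ) :
    gaussTerm 0 (M + 1) = -(X * PowerSeries.C (PowerSeries.C (((M : ℝ) + 1)⁻¹ ^ 2)) *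
      PowerSeries.C (onesTwosSeries 0 (M + 1)) * sineProd M) := by
  induction M with
  | zero =>
    rw [onesTwosSeries_zero_succ', onesTwosSeries_zero_zero]
    simp [gaussTerm, sineProd]
  | succ M ih =>
    have h1 := C_inv_succ_mul (M + 1)
    have h0 := C_inv_succ_mul M
    rw [gaussTerm_succ, ih, onesTwosSeries_zero_succ' (M + 1), sineProd, sineProd,
      prod_range_succ]
    simp only [map_mul, map_add, map_one, map_pow, map_natCast, add_zero] at h1 h0 ⊢
    generalize (PowerSeries.C (PowerSeries.C (((M : ℝ) + 1)⁻¹)) : BiSeries) = w at *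
    generalize (PowerSeries.C (PowerSeries.C ((((M + 1 : ℕ) : ℝ) + 1)⁻¹)) : BiSeries) = v at *
    generalize (∏ k ∈ range M, (1 - _) : BiSeries) = e at *
    generalize (PowerSeries.C (onesTwosSeries 0 (M + 1)) : BiSeries) = h at *
    generalize (PowerSeries.C (shiftGeom (M + 1)) : BiSeries) = g at *
    push_cast at h1 ⊢
    linear_combination (X * v * h * e * g * (1 - w ^ 2 * X)) * h1 -
      (X * v * h * e * g) * (w * ((M : BiSeries) + 1) + 1) * h0

/-- Multiplying by `sineProd` absorbs the implicit term of the recurrence, and each increment is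
minus the next Gauss term. -/
lemma X_mul_onesTwosBiSeries_mul_sineProd (M : ℕ) :
    X * onesTwosBiSeries M * sineProd M = 1 - gaussPartialSum 0 (M + 1) := by
  induction M with
  | zero => simp [onesTwosBiSeries_zero, gaussPartialSum, gaussTerm]
  | succ M ih =>
    have h := gaussTerm_zero_eq M
    have h1 := onesTwosBiSeries_succ M
    rw [gaussPartialSum, sum_range_succ, ← gaussPartialSum, sineProd, prod_range_succ, ← sineProd]
    linear_combination ih + X * sineProd M * h1 + h

lemma X_mul_onesTwosBiSeries (M : ℕ) :
    X * onesTwosBiSeries M = twosBiSeries M * (1 - gaussPartialSum 0 (M + 1)) := by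
  rw [← X_mul_onesTwosBiSeries_mul_sineProd]
  linear_combination (-X * onesTwosBiSeries M) * twosBiSeries_mul_sineProd M

/-! ### Comparison of coefficients and passage to the limit. -/

lemma truncStar_onesTwos_eq (m n M : ℕ) :
    truncStar (onesTwos m (n + 1)) M =
      ∑ q ∈ HasAntidiagonal.antidiagonal (n + 1), truncStar (twos q.1) M *
        (coeff m (coeff q.2 (1 : BiSeries)) - coeff m (coeff q.2 (gaussPartialSum 0 (M + 1)))) := by
  have h := congrArg (fun f => coeff m (coeff (n + 1) f)) (X_mul_onesTwosBiSeries M)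
  rw [coeff_succ_X_mul, PowerSeries.coeff_mul, map_sum] at h
  simpa [onesTwosBiSeries, onesTwosSeries, twosBiSeries] using h

lemma tendsto_truncStar_onesTwos (m n : ℕ) :
    Tendsto (truncStar (onesTwos m (n + 1))) atTop
      (𝓝 (∑ q ∈ HasAntidiagonal.antidiagonal n, (-1 : ℝ) ^ q.2 * mzsv (twos q.1) *
        ∑ d ∈ Finset.Nat.antidiagonalTuple (q.2 + 1) m,
          mzv (fun j => d j + 2) * ∏ j, ((d j : ℝ) + 1))) := by
  have h : Tendsto (truncStar (onesTwos m (n + 1))) atTop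
      (𝓝 (∑ q ∈ HasAntidiagonal.antidiagonal (n + 1), mzsv (twos q.1) *
        (coeff m (coeff q.2 (1 : BiSeries)) -
          (-1) ^ q.2 * ∑ d ∈ Finset.Nat.antidiagonalTuple q.2 m,
            mzv (fun j => d j + 2) * ∏ j, ((d j : ℝ) + 1)))) := by
    refine Tendsto.congr (fun M => (truncStar_onesTwos_eq m n M).symm) ?_
    refine tendsto_finsetSum _ fun q _ => ?_
    exact (hasSum_mzsvTerm_of_two_le (α := twos q.1) fun _ => le_rfl).2.mul
      ((tendsto_coeff_gaussPartialSum q.2 m).const_sub _)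
  convert h using 2
  rw [Finset.Nat.sum_antidiagonal_succ']
  -- The term with exponent zero in `y` vanishes, as the Gauss product has constant term `1`. Hence
  -- the second index is `r + 1`, which accounts for the depth `r + 1` and, with the minus sign, for
  -- `(-1) ^ r`.
  have h0 : coeff m (coeff 0 (1 : BiSeries)) -
      (-1) ^ 0 * ∑ d ∈ Finset.Nat.antidiagonalTuple 0 m,
        mzv (fun j => d j + 2) * ∏ j, ((d j : ℝ) + 1) = 0 := by
    rcases m with _ | m
    · have : mzv (fun j : Fin 0 => (![] : Fin 0 → ℕ) j + 2) = 1 := by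
        refine tendsto_nhds_unique
          (hasSum_mzvTerm_of_two_le (α := fun j : Fin 0 => (![] : Fin 0 → ℕ) j + 2)
            fun i => i.elim0).2 ?_
        have e : truncZeta (fun j : Fin 0 => (![] : Fin 0 → ℕ) j + 2) = fun _ => 1 := by
          funext M
          simp [truncZeta, strictTuples_zero, shiftTerm]
        rw [e]
        exact tendsto_const_nhds
      simp [this]
    · simp [coeff_one]
  simp only [h0, mul_zero, zero_add]
  refine sum_congr rfl fun q _ => ?_
  rw [PowerSeries.coeff_one, if_neg (Nat.succ_ne_zero _), map_zero, pow_succ]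
  ring

end

theorem theorem1p4 (m n : ℕ) :
    Summable (mzsvTerm (onesTwos m (n + 1))) ∧
    (∀ p ≤ n, Summable (mzsvTerm (twos p))) ∧
    (∀ r ≤ n, ∀ d : Fin (r + 1) → ℕ, ∑ j, d j = m → Summable (mzvTerm fun j => d j + 2)) ∧
    mzsv (onesTwos m (n + 1)) =
      ∑ q ∈ Finset.HasAntidiagonal.antidiagonal n, (-1 : ℝ) ^ q.2 * mzsv (twos q.1) *
        ∑ d ∈ Finset.Nat.antidiagonalTuple (q.2 + 1) m,
          mzv (fun j => d j + 2) * ∏ j, ((d j : ℝ) + 1) := by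
  have h := hasSum_mzsvTerm (tendsto_truncStar_onesTwos m n)
  exact ⟨h.summable, fun p _ => (hasSum_mzsvTerm_of_two_le fun _ => le_rfl).1,
    fun r _ d _ => (hasSum_mzvTerm_of_two_le fun _ => by simp).1, h.tsum_eq⟩
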